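/- Let $\mathbb{S}$ be Sierpi\'nski space, the represented space with points $\top,\bot$ in which $0^\omega$ is the only name of $\bot$ and every other $p\in\mathbb{N}^{\mathbb{N}}$ is a name of $\top$. For $A\subseteq\mathbb{N}$ let $S_A$ be the represented space $\{(n,\top)\mid n\in A\}\cup\{(n,\bot)\mid n\notin A\}$, regarded as a subspace of the product $\mathbb{N}\times\mathbb{S}$ of represented spaces (a name of a point of $S_A$ is a name of it in $\mathbb{N}\times\mathbb{S}$). For a transitive relation $\ll$ on $\mathbb{N}$, an ideal is a non-empty set $I\subseteq\mathbb{N}$ such that $x\ll y\in I$ implies $x\in I$, and such that for all $x,y\in I$ there is $z\in I$ with $x\ll z$ and $y\ll z$; let $\mathbf{I}(\ll)$ be the represented space of all ideals of $\ll$, where $p\in\mathbb{N}^{\mathbb{N}}$ is a name of $I$ if and only if $I=\{p(k)\mid k\in\mathbb{N}\}$. A represented space is called precomputably Quasi-Polish if it is computably isomorphic to $\mathbf{I}(\ll)$ for some computably enumerable transitive relation $\ll$ on $\mathbb{N}$, that is, if there is a bijection between the two that is computable in both directions (has a computable realiser on names in each direction). Then for every $A\subseteq\mathbb{N}$, the space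 $S_A$ is precomputably Quasi-Polish if and only if $A$ is $\Delta^0_2$ (both $\Sigma^0_2$ and $\Pi^0_2$ in the arithmetical hierarchy). -/

import Mathlib

/-- The length-`n` prefix `p(0) p(1) … p(n-1)` of a point `p` of Baire space. -/
def bairePrefix (p : ℕ → ℕ) (n : ℕ) : List ℕ := (List.range n).map p

/-- A partial function `F :⊆ ℕ^ℕ → ℕ^ℕ` is computable if it is induced by a computable word function
`h` that is monotone for the prefix order: `F(p)` is defined and equal to `q` exactly when the words
`h(p(0) … p(k-1))` are prefixes of `q` of unbounded length. -/
def IsComputableFunctional (F : (ℕ → ℕ) →. (ℕ → ℕ)) : Prop :=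
  ∃ h : List ℕ → List ℕ, Computable h ∧ (∀ u v : List ℕ, u <+: v → h u <+: h v) ∧
    ∀ p q : ℕ → ℕ, q ∈ F p ↔
      (∀ k : ℕ, h (bairePrefix p k) = bairePrefix q (h (bairePrefix p k)).length) ∧
      (∀ n : ℕ, ∃ k : ℕ, n ≤ (h (bairePrefix p k)).length)

/-- A represented space: a set together with a partial surjection from Baire space onto it.
`x ∈ X.rep p` says that `p` is a name of `x`. -/
structure RepresentedSpace where
  /-- The underlying set. -/
  Carrier : Type
  /-- The representation. -/
  rep : (ℕ → ℕ) →. Carrier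
  /-- Every point has a name. -/
  rep_surjective : ∀ x : Carrier, ∃ p : ℕ → ℕ, x ∈ rep p

namespace RepresentedSpace

/-- `F` realises the total single-valued map `f : X → Y` if it sends every name of a point `x` to
some name of `f x`. -/
def Realises (X Y : RepresentedSpace) (F : (ℕ → ℕ) →. (ℕ → ℕ)) (f : X.Carrier → Y.Carrier) : Prop :=
  ∀ (p : ℕ → ℕ) (x : X.Carrier), x ∈ X.rep p → ∃ q ∈ F p, f x ∈ Y.rep q

/-- A map between represented spaces is computable if it has a computable realiser. -/
def ComputableMap (X Y : RepresentedSpace) (f : X.Carrier → Y.Carrier) : Prop :=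
  ∃ F : (ℕ → ℕ) →. (ℕ → ℕ), IsComputableFunctional F ∧ Realises X Y F f

/-- Computable isomorphism: a bijection that is computable in both directions. -/
def ComputablyIsomorphic (X Y : RepresentedSpace) : Prop :=
  ∃ e : X.Carrier ≃ Y.Carrier, ComputableMap X Y e ∧ ComputableMap Y X e.symm

/-- The natural numbers; `p` is a name of `p 0`. -/
abbrev nat : RepresentedSpace where
  Carrier := ℕ
  rep := fun p => Part.some (p 0)
  rep_surjective := fun n => ⟨fun _ => n, Part.mem_some n⟩

/-- Sierpiński space, with the truth values `⊤` (`True`) and `⊥` (`False`) as points: the zero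
sequence is the only name of `⊥`, every other sequence is a name of `⊤`. -/
abbrev sierpinski : RepresentedSpace where
  Carrier := Prop
  rep := fun p => Part.some (∃ n : ℕ, p n ≠ 0)
  rep_surjective := fun b => by
    by_cases hb : b
    · exact ⟨fun _ => 1, by simp [hb]⟩
    · exact ⟨fun _ => 0, by simp [hb]⟩

/-- The product `X × Y`: `p` is a name of `(x, y)` iff `n ↦ p (2n)` is a name of `x` and
`n ↦ p (2n + 1)` is a name of `y`. -/
abbrev prod (X Y : RepresentedSpace) : RepresentedSpace where
  Carrier := X.Carrier × Y.Carrier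
  rep := fun p =>
    (X.rep fun n => p (2 * n)).bind fun x => (Y.rep fun n => p (2 * n + 1)).map fun y => (x, y)
  rep_surjective := fun z => by
    obtain ⟨p, hp⟩ := X.rep_surjective z.1
    obtain ⟨q, hq⟩ := Y.rep_surjective z.2
    refine ⟨fun n => if n % 2 = 0 then p (n / 2) else q (n / 2), ?_⟩
    have h1 : (fun n : ℕ => if (2 * n) % 2 = 0 then p (2 * n / 2) else q (2 * n / 2)) = p := by
      funext n
      simp
    have h2 : (fun n : ℕ => if (2 * n + 1) % 2 = 0 then p ((2 * n + 1) / 2)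
        else q ((2 * n + 1) / 2)) = q := by
      funext n
      rw [if_neg (by omega), show (2 * n + 1) / 2 = n by omega]
    simp only [h1, h2, Part.mem_bind_iff, Part.mem_map_iff]
    exact ⟨z.1, hp, z.2, hq, rfl⟩

/-- The subspace of `X` on a set `S` of points: a name of a point in `S` is any of its names
in `X`. -/
abbrev subspace (X : RepresentedSpace) (S : Set X.Carrier) : RepresentedSpace where
  Carrier := S
  rep := fun p => ⟨∃ h : (X.rep p).Dom, (X.rep p).get h ∈ S, fun h => ⟨(X.rep p).get h.1, h.2⟩⟩
  rep_surjective := fun x => by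
    obtain ⟨p, hd, hx⟩ := X.rep_surjective x.1
    exact ⟨p, ⟨hd, hx ▸ x.2⟩, Subtype.ext hx⟩

end RepresentedSpace

/-- An ideal of a relation `r` on `ℕ`: a non-empty, downwards closed, upwards directed subset. -/
structure IsRelIdeal (r : ℕ → ℕ → Prop) (I : Set ℕ) : Prop where
  nonempty : I.Nonempty
  down_closed : ∀ x y : ℕ, y ∈ I → r x y → x ∈ I
  directed : ∀ x ∈ I, ∀ y ∈ I, ∃ z ∈ I, r x z ∧ r y z

namespace RepresentedSpace

/-- The space of ideals `I(r)`: `p` is a name of the ideal `I` iff `I = {p(k) | k ∈ ℕ}`. -/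
abbrev idealSpace (r : ℕ → ℕ → Prop) : RepresentedSpace where
  Carrier := {I : Set ℕ // IsRelIdeal r I}
  rep := fun p => ⟨IsRelIdeal r (Set.range p), fun h => ⟨Set.range p, h⟩⟩
  rep_surjective := fun I => by
    obtain ⟨p, hp⟩ := (Set.to_countable I.1).exists_eq_range I.2.nonempty
    exact ⟨p, hp ▸ I.2, Subtype.ext hp.symm⟩

/-- A represented space is precomputably Quasi-Polish if it is computably isomorphic to `I(r)` for
some computably enumerable transitive relation `r` on `ℕ`. -/
def PrecomputablyQuasiPolish (X : RepresentedSpace) : Prop :=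
  ∃ r : ℕ → ℕ → Prop, (∀ x y z : ℕ, r x y → r y z → r x z) ∧
    REPred (fun a : ℕ × ℕ => r a.1 a.2) ∧ ComputablyIsomorphic X (idealSpace r)

/-- The subspace `S_A = {(n, ⊤) | n ∈ A} ∪ {(n, ⊥) | n ∉ A}` of `ℕ × 𝕊`. -/
abbrev spaceOf (A : Set ℕ) : RepresentedSpace :=
  subspace (prod nat sierpinski)
    ({z : ℕ × Prop | ∃ n : ℕ, n ∈ A ∧ z = (n, True)} ∪
      {z : ℕ × Prop | ∃ n : ℕ, n ∉ A ∧ z = (n, False)})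

end RepresentedSpace

/-- `A` is `Σ⁰₂`: `n ∈ A ↔ ∃ a, ∀ b, R(n, a, b)` for some decidable `R`. -/
def IsSigma02 (A : Set ℕ) : Prop :=
  ∃ R : ℕ × ℕ × ℕ → Prop, ComputablePred R ∧ ∀ n : ℕ, n ∈ A ↔ ∃ a : ℕ, ∀ b : ℕ, R (n, a, b)

/-- `A` is `Π⁰₂`: `n ∈ A ↔ ∀ a, ∃ b, R(n, a, b)` for some decidable `R`. -/
def IsPi02 (A : Set ℕ) : Prop :=
  ∃ R : ℕ × ℕ × ℕ → Prop, ComputablePred R ∧ ∀ n : ℕ, n ∈ A ↔ ∀ a : ℕ, ∃ b : ℕ, R (n, a, b)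

/-- `A` is `Δ⁰₂`: both `Σ⁰₂` and `Π⁰₂`. -/
def IsDelta02 (A : Set ℕ) : Prop := IsSigma02 A ∧ IsPi02 A

/-! Suppose `e` is a computable isomorphism from `S_A` to an ideal space. The sequence `n, b, n, b,
…` names `(n, b ≠ 0)` in `ℕ × 𝕊`, a point of `S_A` only if `n ∈ A ↔ b ≠ 0`. A realiser of `e` may do
anything on sequences that name no point of `S_A`, but its output can be tested: enumerating an
ideal of an enumerable relation is a `Π⁰₂` property, and every ideal is the image of a true point of
`S_A`. So the input is a name iff the output enumerates an ideal and the inverse realiser returns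
`n` and the right truth value (`alternating_roundtrip_iff`). This is a `Π⁰₂` condition on `n`; `b =
0` gives the complement of `A`, and `b = 1` gives `A`.

Conversely, if `A` is `Δ⁰₂`, then `A` and its complement have computable counters that are unbounded
exactly at their members (`IsPi02.exists_counter`). `FiberRel.rel` puts two chains over each `n`, a
lower one governed by the counter of the complement and an upper one governed by that of `A`.
Directedness forces the topmost chain met by an ideal to climb forever, so that chain is upper iff
`n ∈ A`. Hence there is exactly one ideal over each `n` (`isRelIdeal_fiberIdeal`,
`exists_eq_fiberIdeal`), and it meets the upper chain iff `n ∈ A`. An enumeration of it thus carries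
the same information as a name of the point over `n`. -/

/-! ### Closure properties of enumerable predicates -/

section REPred

variable {α β : Type*} [Primcodable α] [Primcodable β]

theorem REPred.of_exists_computable {P : α → Prop} {f : α × ℕ → Bool} (hf : Computable f)
    (h : ∀ a, P a ↔ ∃ t, f (a, t) = true) : REPred P := by
  have h1 : Partrec fun a : α => Nat.rfind fun t => (Part.some (f (a, t)) : Part Bool) :=
    Partrec.rfind (p := fun a t => (Part.some (f (a, t)) : Part Bool)) hf.partrec
  have h2 := h1.map ((Computable.const ()).to₂ (α := α) (β := ℕ))
  refine h2.of_eq fun a => Part.ext' ?_ fun _ _ => rfl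
  refine Iff.trans (Nat.rfind_dom (p := fun t => (Part.some (f (a, t)) : Part Bool)))
    (Iff.trans ?_ (exists_prop (b := True)).symm)
  rw [and_true, h a]
  exact exists_congr fun n => ⟨fun hn => (Part.mem_some_iff.1 hn.1).symm,
    fun hn => ⟨Part.mem_some_iff.2 hn.symm, fun _ => trivial⟩⟩

theorem REPred.exists_computable {P : α → Prop} (hP : REPred P) :
    ∃ f : α × ℕ → Bool, Computable f ∧ ∀ a, P a ↔ ∃ t, f (a, t) = true := by
  obtain ⟨c, hc⟩ := Nat.Partrec.Code.exists_code.1 hP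
  refine ⟨fun a => (Nat.Partrec.Code.evaln a.2 c (Encodable.encode a.1)).isSome, ?_, fun a => ?_⟩
  · exact (Primrec.option_isSome.comp (Nat.Partrec.Code.primrec_evaln.comp
      (((Primrec.snd.pair (Primrec.const c))).pair (Primrec.encode.comp Primrec.fst)))).to_comp
  · have h1 : P a ↔ ∃ x, x ∈ Nat.Partrec.Code.eval c (Encodable.encode a) := by
      rw [hc]
      simp [Part.assert, Part.mem_eq]
    rw [h1]
    simp only [Nat.Partrec.Code.evaln_complete, Option.isSome_iff_exists, Option.mem_def]
    exact exists_comm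

theorem REPred.comp {P : β → Prop} (hP : REPred P) {f : α → β} (hf : Computable f) :
    REPred fun a => P (f a) :=
  Partrec.comp hP hf

theorem REPred.of_computable {f : α → Bool} (hf : Computable f) :
    REPred fun a => f a = true :=
  .of_exists_computable (f := fun a => f a.1) (hf.comp .fst) fun a => by simp

theorem REPred.inter {P Q : α → Prop} (hP : REPred P) (hQ : REPred Q) :
    REPred fun a => P a ∧ Q a := by
  obtain ⟨f, hf, hfP⟩ := hP.exists_computable
  obtain ⟨g, hg, hgQ⟩ := hQ.exists_computable
  refine .of_exists_computable
    (f := fun a => f (a.1, a.2.unpair.1) && g (a.1, a.2.unpair.2)) ?_ fun a => ?_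
  · exact Primrec.and.to_comp.comp
      (hf.comp (Computable.fst.pair (Computable.fst.comp (Computable.unpair.comp .snd))))
      (hg.comp (Computable.fst.pair (Computable.snd.comp (Computable.unpair.comp .snd))))
  · rw [hfP, hgQ]
    constructor
    · rintro ⟨⟨s, hs⟩, t, ht⟩
      exact ⟨Nat.pair s t, by simp [hs, ht]⟩
    · rintro ⟨t, ht⟩
      rw [Bool.and_eq_true] at ht
      exact ⟨⟨_, ht.1⟩, _, ht.2⟩

theorem REPred.union {P Q : α → Prop} (hP : REPred P) (hQ : REPred Q) :
    REPred fun a => P a ∨ Q a := by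
  obtain ⟨f, hf, hfP⟩ := hP.exists_computable
  obtain ⟨g, hg, hgQ⟩ := hQ.exists_computable
  refine .of_exists_computable (f := fun a => f a || g a) (Primrec.or.to_comp.comp hf hg) fun a => ?_
  simp only [hfP, hgQ, Bool.or_eq_true, exists_or]

theorem REPred.exists {P : α × β → Prop} (hP : REPred P) : REPred fun a => ∃ x, P (a, x) := by
  obtain ⟨f, hf, hfP⟩ := hP.exists_computable
  -- A single number codes both the witness and the stage that confirms it; numbers coding no
  -- witness count as failures.
  refine .of_exists_computable (f := fun a =>
    ((Encodable.decode (α := β) a.2.unpair.1).map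
      fun x => f ((a.1, x), a.2.unpair.2)).getD false) ?_ fun a => ?_
  · refine Computable.option_getD (Computable.option_map
      (Computable.decode.comp (Computable.fst.comp (Computable.unpair.comp .snd))) ?_) (.const _)
    exact hf.comp (((Computable.fst.comp .fst).pair .snd).pair
      (Computable.snd.comp (Computable.unpair.comp (Computable.snd.comp .fst))))
  · simp only [hfP]
    constructor
    · rintro ⟨x, t, h⟩
      exact ⟨Nat.pair (Encodable.encode x) t, by simp [h]⟩
    · rintro ⟨t, h⟩
      cases hd : Encodable.decode (α := β) t.unpair.1 with
      | none => simp [hd] at h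
      | some x => exact ⟨x, t.unpair.2, by simpa [hd] using h⟩

end REPred

/-! ### `Π⁰₂` sets -/

/-- A set of numbers is `Π⁰₂` if it is a universal projection of an enumerable relation. -/
theorem isPi02_of_forall {β : Type*} [Primcodable β] {P : ℕ × β → Prop} (hP : REPred P) :
    IsPi02 {n | ∀ x, P (n, x)} := by
  obtain ⟨f, hf, hfP⟩ := hP.exists_computable
  -- The default is `true`, so that numbers coding no element of `β` impose no condition.
  refine ⟨fun m => ((Encodable.decode (α := β) m.2.1).map
    fun x => f ((m.1, x), m.2.2)).getD true = true, ⟨inferInstance, ?_⟩, fun n => ?_⟩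
  · simp only [Bool.decide_eq_true]
    refine Computable.option_getD (Computable.option_map
      (Computable.decode.comp (Computable.fst.comp .snd)) ?_) (.const _)
    exact hf.comp (((Computable.fst.comp .fst).pair .snd).pair
      (Computable.snd.comp (Computable.snd.comp .fst)))
  · simp only [Set.mem_ofPred_eq, hfP]
    constructor
    · intro h a
      cases hd : Encodable.decode (α := β) a with
      | none => exact ⟨0, by simp⟩
      | some x => simpa using h x
    · intro h x
      simpa using h (Encodable.encode x)

theorem isPi02_of_rePred {P : ℕ → Prop} (hP : REPred P) : IsPi02 {n | P n} := by
  have := isPi02_of_forall (β := ℕ) (P := fun a => P a.1) (hP.comp .fst)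
  simpa using this

theorem IsPi02.exists_rePred {A : Set ℕ} (hA : IsPi02 A) :
    ∃ P : ℕ × ℕ → Prop, REPred P ∧ ∀ n, n ∈ A ↔ ∀ a, P (n, a) := by
  obtain ⟨R, ⟨_, hR⟩, hA⟩ := hA
  refine ⟨fun m => ∃ b, R (m.1, m.2, b), ?_, hA⟩
  refine .of_exists_computable (f := fun a => decide (R (a.1.1, a.1.2, a.2))) ?_ (by simp)
  exact hR.comp ((Computable.fst.comp .fst).pair ((Computable.snd.comp .fst).pair .snd))

theorem IsPi02.inter {A B : Set ℕ} (hA : IsPi02 A) (hB : IsPi02 B) : IsPi02 (A ∩ B) := by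
  obtain ⟨P, hP, hA⟩ := hA.exists_rePred
  obtain ⟨Q, hQ, hB⟩ := hB.exists_rePred
  convert isPi02_of_forall (hP.inter hQ) using 1
  ext n
  simp [hA, hB, forall_and]

theorem IsPi02.isSigma02_of_compl {A : Set ℕ} (hA : IsPi02 Aᶜ) : IsSigma02 A := by
  obtain ⟨R, hR, h⟩ := hA
  refine ⟨fun m => ¬ R m, hR.not, fun n => ?_⟩
  rw [← not_iff_not, ← Set.mem_compl_iff, h n]
  push Not
  rfl

theorem IsSigma02.compl {A : Set ℕ} (hA : IsSigma02 A) : IsPi02 Aᶜ := by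
  obtain ⟨R, hR, h⟩ := hA
  refine ⟨fun m => ¬ R m, hR.not, fun n => ?_⟩
  rw [Set.mem_compl_iff, h n]
  push Not
  rfl

/-! ### Limits of growing words -/

section Limits

@[simp] theorem length_bairePrefix (p : ℕ → ℕ) (n : ℕ) : (bairePrefix p n).length = n := by
  simp [bairePrefix]

theorem getElem?_bairePrefix {p : ℕ → ℕ} {n i : ℕ} (h : i < n) :
    (bairePrefix p n)[i]? = some (p i) := by
  simp [bairePrefix, h]

theorem bairePrefix_prefix (p : ℕ → ℕ) {m n : ℕ} (h : m ≤ n) :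
    bairePrefix p m <+: bairePrefix p n := by
  obtain ⟨k, rfl⟩ := Nat.exists_eq_add_of_le h
  exact ⟨(List.range k).map fun i => p (m + i), by
    simp [bairePrefix, List.range_add, Function.comp_def]⟩

theorem mem_bairePrefix {p : ℕ → ℕ} {n y : ℕ} : y ∈ bairePrefix p n ↔ ∃ i < n, p i = y := by
  simp [bairePrefix]

/-- The words `W 0, W 1, …` are prefixes of `q` of unbounded length. -/
def IsWordLimit (W : ℕ → List ℕ) (q : ℕ → ℕ) : Prop :=
  (∀ k : ℕ, W k = bairePrefix q (W k).length) ∧ ∀ n : ℕ, ∃ k : ℕ, n ≤ (W k).length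

variable {W : ℕ → List ℕ} {q : ℕ → ℕ}

theorem IsWordLimit.getElem?_eq (h : IsWordLimit W q) {k i : ℕ} (hi : i < (W k).length) :
    (W k)[i]? = some (q i) := by
  rw [h.1 k]
  exact getElem?_bairePrefix hi

theorem IsWordLimit.exists_getElem?_eq (h : IsWordLimit W q) {i m : ℕ} :
    (∃ k, (W k)[i]? = some m) ↔ q i = m := by
  constructor
  · rintro ⟨k, hk⟩
    have hi : i < (W k).length := (List.getElem?_eq_some_iff.1 hk).1
    rw [h.getElem?_eq hi] at hk
    exact Option.some.inj hk
  · rintro rfl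
    obtain ⟨k, hk⟩ := h.2 (i + 1)
    exact ⟨k, h.getElem?_eq hk⟩

/-- The default `0` makes an entry that is not yet written look like `⊥`, so a nonzero value is
always genuine. -/
theorem IsWordLimit.exists_getD_ne_zero (h : IsWordLimit W q) {i : ℕ} :
    (∃ k, (W k).getD i 0 ≠ 0) ↔ q i ≠ 0 := by
  constructor
  · rintro ⟨k, hk⟩
    by_cases hi : i < (W k).length
    · simpa [List.getD_eq_getElem?_getD, h.getElem?_eq hi] using hk
    · simp [List.getD_eq_getElem?_getD, hi] at hk
  · intro hq
    obtain ⟨k, hk⟩ := h.2 (i + 1)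
    exact ⟨k, by simpa [List.getD_eq_getElem?_getD, h.getElem?_eq hk] using hq⟩

theorem IsWordLimit.mem_range (h : IsWordLimit W q) {y : ℕ} :
    y ∈ Set.range q ↔ ∃ k, y ∈ W k := by
  constructor
  · rintro ⟨i, rfl⟩
    obtain ⟨k, hk⟩ := h.2 (i + 1)
    exact ⟨k, List.mem_of_getElem? (h.getElem?_eq hk)⟩
  · rintro ⟨k, hk⟩
    rw [h.1 k, mem_bairePrefix] at hk
    obtain ⟨i, -, hi⟩ := hk
    exact ⟨i, hi⟩

theorem exists_isWordLimit (hW : ∀ j k, j ≤ k → W j <+: W k)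
    (h : ∀ n, ∃ k, n ≤ (W k).length) : ∃ q, IsWordLimit W q := by
  -- Any stage at which entry `i` is written will do: two stages are comparable, so they agree on
  -- it.
  choose κ hκ using fun i => h (i + 1)
  refine ⟨fun i => (W (κ i)).getD i 0, fun k => ?_, h⟩
  refine List.ext_getElem? fun i => ?_
  by_cases hi : i < (W k).length
  · have h1 : i < (W (κ i)).length := hκ i
    rw [getElem?_bairePrefix hi, List.getD_eq_getElem _ _ h1, List.getElem?_eq_getElem hi]
    congr 1
    rcases le_total k (κ i) with hle | hle
    · exact (hW _ _ hle).getElem hi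
    · exact ((hW _ _ hle).getElem h1).symm
  · rw [List.getElem?_eq_none (not_lt.1 hi), List.getElem?_eq_none (by simpa using hi)]

/-- The words `W k` are cofinal among the prefixes of `q`. This lets the composite of two
functionals be computed by composing their word functions, without mentioning the intermediate
limit. -/
theorem IsWordLimit.comp {g : List ℕ → List ℕ} (hg : ∀ u v : List ℕ, u <+: v → g u <+: g v)
    (h : IsWordLimit W q) {s : ℕ → ℕ} (hs : IsWordLimit (fun k => g (bairePrefix q k)) s) :
    IsWordLimit (fun k => g (W k)) s := by
  refine ⟨fun k => ?_, fun n => ?_⟩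
  · have := hs.1 (W k).length
    simp only [← h.1 k] at this
    exact this
  · obtain ⟨j, hj⟩ := hs.2 n
    obtain ⟨k, hk⟩ := h.2 j
    refine ⟨k, hj.trans ?_⟩
    have := (hg _ _ (bairePrefix_prefix q hk)).length_le
    rwa [← h.1 k] at this

theorem IsWordLimit.isRelIdeal_range (hW : ∀ j k, j ≤ k → W j <+: W k) (h : IsWordLimit W q)
    (r : ℕ → ℕ → Prop) : IsRelIdeal r (Set.range q) ↔
      (∀ x y k, y ∈ W k → r x y → ∃ k', x ∈ W k') ∧
      (∀ x y k, x ∈ W k → y ∈ W k → ∃ z k', z ∈ W k' ∧ r x z ∧ r y z) := by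
  constructor
  · intro hI
    refine ⟨fun x y k hy hr => h.mem_range.1 (hI.down_closed x y (h.mem_range.2 ⟨k, hy⟩) hr),
      fun x y k hx hy => ?_⟩
    obtain ⟨z, hz, hr⟩ := hI.directed x (h.mem_range.2 ⟨k, hx⟩) y (h.mem_range.2 ⟨k, hy⟩)
    obtain ⟨k', hk'⟩ := h.mem_range.1 hz
    exact ⟨z, k', hk', hr⟩
  · rintro ⟨h1, h2⟩
    refine ⟨Set.range_nonempty q, fun x y hy hr => ?_, fun x hx y hy => ?_⟩
    · obtain ⟨k, hk⟩ := h.mem_range.1 hy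
      exact h.mem_range.2 (h1 x y k hk hr)
    · obtain ⟨j, hj⟩ := h.mem_range.1 hx
      obtain ⟨k, hk⟩ := h.mem_range.1 hy
      obtain ⟨z, k', hz, hr⟩ := h2 x y (max j k) ((hW _ _ (le_max_left j k)).subset hj)
        ((hW _ _ (le_max_right j k)).subset hk)
      exact ⟨z, h.mem_range.2 ⟨k', hz⟩, hr⟩

end Limits

/-! ### Names of points of `S_A` and the round trip through the ideal space -/

/-- The sequence `a, b, a, b, …`. -/
def alternating (a b : ℕ) (i : ℕ) : ℕ := if i % 2 = 0 then a else b

theorem computable_bairePrefix_alternating (b : ℕ) :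
    Computable fun a : ℕ × ℕ => bairePrefix (alternating a.1 b) a.2 := by
  refine (Primrec.list_map (Primrec.list_range.comp Primrec.snd)
    (g := fun a i => alternating a.1 b i) ?_).to_comp
  exact Primrec.ite (Primrec.eq.comp (Primrec.nat_mod.comp Primrec.snd (Primrec.const 2))
    (Primrec.const 0)) (Primrec.fst.comp Primrec.fst) (Primrec.const b)

namespace RepresentedSpace

variable {A : Set ℕ}

theorem mem_spaceOf_rep {p : ℕ → ℕ} {x : (spaceOf A).Carrier} :
    x ∈ (spaceOf A).rep p ↔ x.1 = (p 0, ∃ i, p (2 * i + 1) ≠ 0) := by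
  have key : (prod nat sierpinski).rep p = Part.some (p 0, ∃ i, p (2 * i + 1) ≠ 0) := by
    simp
  constructor
  · rintro ⟨h, rfl⟩
    exact Part.mem_some_iff.1 (key ▸ Part.get_mem h.1)
  · intro hx
    obtain ⟨hd, hg⟩ : x.1 ∈ (prod nat sierpinski).rep p := key ▸ Part.mem_some_iff.2 hx
    exact ⟨⟨hd, hg ▸ x.2⟩, Subtype.ext hg⟩

theorem spaceOf_snd_iff (x : (spaceOf A).Carrier) : x.1.2 ↔ x.1.1 ∈ A := by
  obtain ⟨x, ⟨n, hn, rfl⟩ | ⟨n, hn, rfl⟩⟩ := x <;> simpa using hn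

theorem mem_spaceOf_set {n : ℕ} {b : Prop} (h : b ↔ n ∈ A) :
    (n, b) ∈ ({z : ℕ × Prop | ∃ n : ℕ, n ∈ A ∧ z = (n, True)} ∪
      {z : ℕ × Prop | ∃ n : ℕ, n ∉ A ∧ z = (n, False)}) := by
  by_cases hn : n ∈ A
  · exact Or.inl ⟨n, hn, by simp [h, hn]⟩
  · exact Or.inr ⟨n, hn, by simp [h, hn]⟩

theorem mem_idealSpace_rep {r : ℕ → ℕ → Prop} {p : ℕ → ℕ} {I : (idealSpace r).Carrier} :
    I ∈ (idealSpace r).rep p ↔ I.1 = Set.range p :=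
  ⟨fun ⟨_, h⟩ => h ▸ rfl, fun h =>
    ⟨show IsRelIdeal r (Set.range p) from h ▸ I.2, Subtype.ext h.symm⟩⟩

/-- The alternating sequence `n, b, n, b, …` names a point of `S_A` exactly when the isomorphism
with the ideal space and its inverse carry it to an ideal and back to a name of the same kind. -/
theorem alternating_roundtrip_iff {r : ℕ → ℕ → Prop} {e : (spaceOf A).Carrier ≃ (idealSpace r).Carrier}
    {F G : (ℕ → ℕ) →. (ℕ → ℕ)} {f g : List ℕ → List ℕ}
    (hF : Realises (spaceOf A) (idealSpace r) F e)
    (hG : Realises (idealSpace r) (spaceOf A) G e.symm)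
    (hg : ∀ u v : List ℕ, u <+: v → g u <+: g v)
    (hfF : ∀ p q, q ∈ F p ↔ IsWordLimit (fun k => f (bairePrefix p k)) q)
    (hgG : ∀ p q, q ∈ G p ↔ IsWordLimit (fun k => g (bairePrefix p k)) q) (n b : ℕ) :
    ((∃ q, IsWordLimit (fun k => f (bairePrefix (alternating n b) k)) q ∧
        IsRelIdeal r (Set.range q)) ∧
      (∃ k, (g (f (bairePrefix (alternating n b) k)))[0]? = some n) ∧
      ((∃ i k, (g (f (bairePrefix (alternating n b) k))).getD (2 * i + 1) 0 ≠ 0) ↔ b ≠ 0)) ↔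
    (n ∈ A ↔ b ≠ 0) := by
  constructor
  · rintro ⟨⟨q, hq, hI⟩, h0, hodd⟩
    -- Convergence of `G` is automatic because `q` names an ideal; the point named by `s` is a true
    -- point of `S_A`, whose second component decides membership in `A`.
    obtain ⟨s, hs, hsx⟩ := hG q ⟨Set.range q, hI⟩ (mem_idealSpace_rep.2 rfl)
    have hlim := hq.comp hg ((hgG q s).1 hs)
    simp only [hlim.exists_getElem?_eq, hlim.exists_getD_ne_zero] at h0 hodd
    rw [mem_spaceOf_rep] at hsx
    have := spaceOf_snd_iff (e.symm ⟨Set.range q, hI⟩)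
    rw [hsx] at this
    simp only [h0] at this
    rw [← this, hodd]
  · intro hn
    let x : (spaceOf A).Carrier := ⟨(n, b ≠ 0), mem_spaceOf_set hn.symm⟩
    have hx : x ∈ (spaceOf A).rep (alternating n b) := by
      rw [mem_spaceOf_rep]
      simp [x, alternating]
    obtain ⟨q, hq, hqx⟩ := hF _ _ hx
    obtain ⟨s, hs, hsx⟩ := hG _ _ hqx
    have hlim := ((hfF _ _).1 hq).comp hg ((hgG q s).1 hs)
    rw [Equiv.symm_apply_apply, mem_spaceOf_rep] at hsx
    obtain ⟨h0, hodd⟩ := Prod.mk.inj hsx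
    refine ⟨⟨q, (hfF _ _).1 hq, ?_⟩, ?_⟩
    · rw [← mem_idealSpace_rep.1 hqx]
      exact (e x).2
    · simp only [hlim.exists_getElem?_eq, hlim.exists_getD_ne_zero]
      exact ⟨h0.symm, iff_of_eq hodd.symm⟩

end RepresentedSpace

/-! ### The round-trip conditions are `Π⁰₂` -/

section Complexity

variable {W : ℕ → ℕ → List ℕ}

theorem computable_mem_list {α : Type*} [Primcodable α] {f : α → ℕ} {g : α → List ℕ}
    (hf : Computable f) (hg : Computable g) : Computable fun a => decide (f a ∈ g a) := by
  have h : PrimrecRel fun (l : List ℕ) (x : ℕ) => ∃ y ∈ l, y = x := Primrec.eq.exists_mem_list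
  exact (h.decide.to_comp.comp hg hf).of_eq fun a => by simp

/-- By monotonicity the limit exists iff the lengths are unbounded, and the ideal conditions can be
stated about the words alone. In each of them the premise is replaced by a decidable event at a
given stage, while the conclusion is enumerable, so the form is `∀∃`. -/
theorem isPi02_isWordLimit_isRelIdeal (hW : Computable fun a : ℕ × ℕ => W a.1 a.2)
    (hmono : ∀ n j k, j ≤ k → W n j <+: W n k) {r : ℕ → ℕ → Prop}
    (hr : REPred fun a : ℕ × ℕ => r a.1 a.2) :
    IsPi02 {n | ∃ q, IsWordLimit (W n) q ∧ IsRelIdeal r (Set.range q)} := by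
  have hmem : ∀ {α : Type} [Primcodable α] {x n k : α → ℕ}, Computable x → Computable n →
      Computable k → Computable fun a => decide (x a ∈ W (n a) (k a)) :=
    fun hx hn hk => computable_mem_list hx (hW.comp (hn.pair hk))
  have hmemRE : ∀ {α : Type} [Primcodable α] {x n k : α → ℕ}, Computable x → Computable n →
      Computable k → REPred fun a => x a ∈ W (n a) (k a) :=
    fun hx hn hk => (REPred.of_computable (hmem hx hn hk)).of_eq fun a => by simp
  have h1 : IsPi02 {n | ∀ N, ∃ k, N ≤ (W n k).length} := by
    refine isPi02_of_forall (P := fun a : ℕ × ℕ => ∃ k, a.2 ≤ (W a.1 k).length) ?_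
    refine REPred.exists (P := fun a : (ℕ × ℕ) × ℕ => a.1.2 ≤ (W a.1.1 a.2).length) ?_
    refine (REPred.of_computable (Primrec.nat_le.decide.to_comp.comp
      (Computable.snd.comp .fst) (Computable.list_length.comp
        (hW.comp ((Computable.fst.comp .fst).pair .snd))))).of_eq fun a => by simp
  obtain ⟨f, hf, hfr⟩ := hr.exists_computable
  have h2 : IsPi02 {n | ∀ a : (ℕ × ℕ) × ℕ × ℕ, (decide (a.1.2 ∈ W n a.2.1) && f (a.1, a.2.2)) = false ∨
      ∃ k', a.1.1 ∈ W n k'} := by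
    refine isPi02_of_forall (P := fun b : ℕ × (ℕ × ℕ) × ℕ × ℕ =>
      (decide (b.2.1.2 ∈ W b.1 b.2.2.1) && f (b.2.1, b.2.2.2)) = false ∨
      ∃ k', b.2.1.1 ∈ W b.1 k') (.union ?_ (.exists (β := ℕ)
        (P := fun c : (ℕ × (ℕ × ℕ) × ℕ × ℕ) × ℕ => c.1.2.1.1 ∈ W c.1.1 c.2) ?_))
    · refine (REPred.of_computable (Primrec.not.to_comp.comp (Primrec.and.to_comp.comp
        (hmem (Computable.snd.comp (Computable.fst.comp .snd)) .fst
          (Computable.fst.comp (Computable.snd.comp .snd)))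
        (hf.comp ((Computable.fst.comp .snd).pair
          (Computable.snd.comp (Computable.snd.comp .snd))))))).of_eq
          fun a => by rw [Bool.not_eq_true']
    · exact hmemRE (Computable.fst.comp (Computable.fst.comp (Computable.snd.comp .fst)))
        (Computable.fst.comp .fst) .snd
  have h3 : IsPi02 {n | ∀ a : (ℕ × ℕ) × ℕ,
      (decide (a.1.1 ∈ W n a.2) && decide (a.1.2 ∈ W n a.2)) = false ∨
      ∃ b : ℕ × ℕ, b.1 ∈ W n b.2 ∧ r a.1.1 b.1 ∧ r a.1.2 b.1} := by
    refine isPi02_of_forall (P := fun b : ℕ × (ℕ × ℕ) × ℕ =>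
      (decide (b.2.1.1 ∈ W b.1 b.2.2) && decide (b.2.1.2 ∈ W b.1 b.2.2)) = false ∨
      ∃ c : ℕ × ℕ, c.1 ∈ W b.1 c.2 ∧ r b.2.1.1 c.1 ∧ r b.2.1.2 c.1) (.union ?_
        (.exists (β := ℕ × ℕ) (P := fun d : (ℕ × (ℕ × ℕ) × ℕ) × ℕ × ℕ =>
          d.2.1 ∈ W d.1.1 d.2.2 ∧ r d.1.2.1.1 d.2.1 ∧ r d.1.2.1.2 d.2.1) ?_))
    · refine (REPred.of_computable (Primrec.not.to_comp.comp (Primrec.and.to_comp.comp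
        (hmem (Computable.fst.comp (Computable.fst.comp .snd)) .fst
          (Computable.snd.comp .snd))
        (hmem (Computable.snd.comp (Computable.fst.comp .snd)) .fst
          (Computable.snd.comp .snd))))).of_eq fun a => by rw [Bool.not_eq_true']
    · have hz : Computable fun d : (ℕ × (ℕ × ℕ) × ℕ) × ℕ × ℕ => d.2.1 := Computable.fst.comp .snd
      have hxy : Computable fun d : (ℕ × (ℕ × ℕ) × ℕ) × ℕ × ℕ => d.1.2.1 :=
        Computable.fst.comp (Computable.snd.comp .fst)
      have hx : REPred fun d : (ℕ × (ℕ × ℕ) × ℕ) × ℕ × ℕ => r d.1.2.1.1 d.2.1 :=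
        REPred.comp hr (f := fun d : (ℕ × (ℕ × ℕ) × ℕ) × ℕ × ℕ => (d.1.2.1.1, d.2.1))
          ((Computable.fst.comp hxy).pair hz)
      have hy : REPred fun d : (ℕ × (ℕ × ℕ) × ℕ) × ℕ × ℕ => r d.1.2.1.2 d.2.1 :=
        REPred.comp hr (f := fun d : (ℕ × (ℕ × ℕ) × ℕ) × ℕ × ℕ => (d.1.2.1.2, d.2.1))
          ((Computable.snd.comp hxy).pair hz)
      have hm : REPred fun d : (ℕ × (ℕ × ℕ) × ℕ) × ℕ × ℕ => d.2.1 ∈ W d.1.1 d.2.2 :=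
        hmemRE hz (Computable.fst.comp .fst) (Computable.snd.comp .snd)
      exact hm.inter (hx.inter hy)
  convert h1.inter (h2.inter h3) using 1
  ext n
  have hiff := fun q (hq : IsWordLimit (W n) q) => hq.isRelIdeal_range (hmono n) r
  simp only [Set.mem_ofPred_eq, Set.mem_inter_iff]
  constructor
  · rintro ⟨q, hq, hI⟩
    obtain ⟨hd, hdir⟩ := (hiff q hq).1 hI
    refine ⟨hq.2, fun a => ?_, fun a => ?_⟩
    · by_cases hc : a.1.2 ∈ W n a.2.1 ∧ f (a.1, a.2.2) = true
      · exact Or.inr (hd _ _ _ hc.1 ((hfr a.1).2 ⟨_, hc.2⟩))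
      · left; simpa using hc
    · by_cases hc : a.1.1 ∈ W n a.2 ∧ a.1.2 ∈ W n a.2
      · obtain ⟨z, k', h⟩ := hdir _ _ _ hc.1 hc.2
        exact Or.inr ⟨(z, k'), h⟩
      · left; simpa using hc
  · rintro ⟨hu, hd, hdir⟩
    obtain ⟨q, hq⟩ := exists_isWordLimit (hmono n) hu
    refine ⟨q, hq, (hiff q hq).2 ⟨fun x y k hy hxy => ?_, fun x y k hx hy => ?_⟩⟩
    · obtain ⟨t, ht⟩ := (hfr (x, y)).1 hxy
      simpa [hy, ht] using hd ((x, y), k, t)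
    · simpa [hx, hy] using hdir ((x, y), k)

theorem isPi02_exists_head (hW : Computable fun a : ℕ × ℕ => W a.1 a.2) :
    IsPi02 {n | ∃ k, (W n k)[0]? = some n} := by
  refine isPi02_of_rePred (.exists (P := fun a : ℕ × ℕ => (W a.1 a.2)[0]? = some a.1) ?_)
  exact (REPred.of_computable (Primrec.eq.decide.to_comp.comp
    (Computable.list_getElem?.comp hW (.const 0)) (Computable.option_some.comp .fst))).of_eq
    fun a => by simp

/-- For `b = 0` all odd entries must vanish, a universal condition; otherwise some odd entry must be
nonzero, an enumerable one. -/
theorem isPi02_exists_odd_iff (hW : Computable fun a : ℕ × ℕ => W a.1 a.2) (b : ℕ) :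
    IsPi02 {n | (∃ i k, (W n k).getD (2 * i + 1) 0 ≠ 0) ↔ b ≠ 0} := by
  have h : Computable fun a : ℕ × ℕ × ℕ =>
      decide ((W a.1 a.2.2).getD (2 * a.2.1 + 1) 0 = 0) :=
    Primrec.eq.decide.to_comp.comp ((Primrec.list_getD 0).to_comp.comp
      (hW.comp (Computable.fst.pair (Computable.snd.comp .snd)))
      (Primrec.nat_double_succ.to_comp.comp (Computable.fst.comp .snd))) (.const 0)
  by_cases hb : b = 0
  · convert isPi02_of_forall (REPred.of_computable h) using 1
    ext n
    simp [hb]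
  · convert isPi02_of_rePred ((REPred.of_computable (Primrec.not.to_comp.comp h)).exists) using 1
    ext n
    simp [hb]

end Complexity

theorem RepresentedSpace.PrecomputablyQuasiPolish.isDelta02 {A : Set ℕ}
    (hA : (spaceOf A).PrecomputablyQuasiPolish) : IsDelta02 A := by
  obtain ⟨r, -, hr, e, ⟨F, ⟨f, hf, hfm, hfF⟩, hF⟩, ⟨G, ⟨g, hg, hgm, hgG⟩, hG⟩⟩ := hA
  have key : ∀ b, IsPi02 {n | n ∈ A ↔ b ≠ 0} := fun b => by
    have hW : Computable fun a : ℕ × ℕ => f (bairePrefix (alternating a.1 b) a.2) :=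
      hf.comp (computable_bairePrefix_alternating b)
    have hV : Computable fun a : ℕ × ℕ => g (f (bairePrefix (alternating a.1 b) a.2)) :=
      hg.comp hW
    convert (isPi02_isWordLimit_isRelIdeal
      (W := fun n k => f (bairePrefix (alternating n b) k)) hW
      (fun n j k hjk => hfm _ _ (bairePrefix_prefix _ hjk)) hr).inter
      ((isPi02_exists_head
        (W := fun n k => g (f (bairePrefix (alternating n b) k))) hV).inter
      (isPi02_exists_odd_iff (W := fun n k => g (f (bairePrefix (alternating n b) k))) hV b)) using 1
    ext n
    exact (alternating_roundtrip_iff hF hG hgm hfF hgG n b).symm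
  refine ⟨IsPi02.isSigma02_of_compl ?_, ?_⟩
  · simpa [Set.compl_def] using! key 0
  · simpa using! key 1

/-! ### Counters for `Π⁰₂` sets -/

/-- One step of the search that looks, for `a = 0, 1, …` in turn, for some `b` with `f (n, a, b)`;
the state is `(a, b)`. -/
def searchStep (f : ℕ × ℕ × ℕ → Bool) (n : ℕ) (s : ℕ × ℕ) : ℕ × ℕ :=
  cond (f (n, s)) (s.1 + 1, 0) (s.1, s.2 + 1)

def searchState (f : ℕ × ℕ × ℕ → Bool) (n t : ℕ) : ℕ × ℕ :=
  Nat.rec (0, 0) (fun _ s => searchStep f n s) t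

theorem searchState_succ (f : ℕ × ℕ × ℕ → Bool) (n t : ℕ) :
    searchState f n (t + 1) = searchStep f n (searchState f n t) := rfl

theorem computable_searchStep {f : ℕ × ℕ × ℕ → Bool} (hf : Computable f) :
    Computable fun a : ℕ × ℕ × ℕ => searchStep f a.1 a.2 :=
  Computable.cond hf
    ((Computable.succ.comp (Computable.fst.comp .snd)).pair (.const 0))
    ((Computable.fst.comp .snd).pair (Computable.succ.comp (Computable.snd.comp .snd)))

theorem computable_fst_fst_snd_snd {α β γ δ : Type*} [Primcodable α] [Primcodable β]
    [Primcodable γ] [Primcodable δ] :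
    Computable fun b : (α × β) × γ × δ => (b.1.1, b.2.2) :=
  (Computable.fst.comp .fst).pair (Computable.snd.comp .snd)

theorem computable₂_searchStep {f : ℕ × ℕ × ℕ → Bool} (hf : Computable f) :
    Computable₂ fun (a : ℕ × ℕ) (s : ℕ × ℕ × ℕ) => searchStep f a.1 s.2 :=
  Computable.of_eq (Computable.comp (computable_searchStep hf) computable_fst_fst_snd_snd)
    fun _ => rfl

theorem computable_searchState {f : ℕ × ℕ × ℕ → Bool} (hf : Computable f) :
    Computable fun a : ℕ × ℕ => searchState f a.1 a.2 :=
  (Computable.nat_rec (f := fun a : ℕ × ℕ => a.2) (g := fun _ => ((0, 0) : ℕ × ℕ))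
    Computable.snd (.const (0, 0)) (computable₂_searchStep hf)).of_eq fun _ => rfl

/-- A `Π⁰₂` set has a computable counter that is unbounded exactly at its members. -/
theorem IsPi02.exists_counter {B : Set ℕ} (hB : IsPi02 B) :
    ∃ c : ℕ × ℕ → ℕ, Computable c ∧ ∀ n, n ∈ B ↔ ∀ K, ∃ t, K ≤ c (n, t) := by
  obtain ⟨R, ⟨_, hR⟩, hB⟩ := hB
  let state := searchState fun m => decide (R m)
  have hsucc : ∀ n t, state n (t + 1) = searchStep (fun m => decide (R m)) n (state n t) :=
    searchState_succ _
  refine ⟨fun a => (state a.1 a.2).1, Computable.fst.comp (computable_searchState hR),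
    fun n => ?_⟩
  · rw [hB]
    constructor
    · intro h K
      suffices ∃ t, state n t = (K, 0) from this.imp fun t ht => by simp [ht]
      induction K with
      | zero => exact ⟨0, rfl⟩
      | succ K ih =>
        obtain ⟨t, ht⟩ := ih
        have hK := h K
        -- Until the least witness for `K` is reached, only the second component moves.
        have hrun : ∀ j ≤ Nat.find hK, state n (t + j) = (K, j) := by
          intro j
          induction j with
          | zero => exact fun _ => ht
          | succ j ihj =>
            intro hj
            have hn := Nat.find_min hK (m := j) (by omega)
            rw [← add_assoc, hsucc, ihj (by omega)]
            simp [searchStep, hn]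
        refine ⟨t + Nat.find hK + 1, ?_⟩
        rw [hsucc, hrun _ le_rfl]
        simp [searchStep, Nat.find_spec hK]
    · intro h a
      -- Invariant: every value the search has passed has a witness.
      have hinv : ∀ t a, a < (state n t).1 → ∃ b, R (n, a, b) := by
        intro t
        induction t with
        | zero => exact fun a ha => absurd ha (Nat.not_lt_zero a)
        | succ t ih =>
          intro a ha
          rw [hsucc] at ha
          by_cases hd : R (n, state n t)
          · simp only [searchStep, hd, decide_true, cond_true] at ha
            rcases Nat.lt_succ_iff_lt_or_eq.1 ha with hlt | rfl
            · exact ih a hlt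
            · exact ⟨_, hd⟩
          · simp only [searchStep, hd, decide_false, cond_false] at ha
            exact ih a ha
      obtain ⟨t, ht⟩ := h (a + 1)
      exact hinv t a ht

/-! ### A class of computable functionals -/

/-- A functional whose `i`-th output depends only on `i` and on the entries of the input at `0` and
at a position `σ i ≤ i` is computable. -/
theorem isComputableFunctional_of_primrec {φ : ℕ × ℕ × ℕ → ℕ} {σ : ℕ → ℕ} (hφ : Primrec φ)
    (hσ : Primrec σ) (hle : ∀ i, σ i ≤ i) :
    IsComputableFunctional fun p => Part.some fun i => φ (p 0, p (σ i), i) := by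
  -- One output entry per input entry: since `σ i ≤ i`, the default `0` is never used.
  refine ⟨fun u => (List.range u.length).map fun i => φ (u.getD 0 0, u.getD (σ i) 0, i),
    ?_, ?_, fun p q => ?_⟩
  · refine (Primrec.list_map (Primrec.list_range.comp Primrec.list_length)
      (g := fun (u : List ℕ) i => φ (u.getD 0 0, u.getD (σ i) 0, i)) ?_).to_comp
    exact hφ.comp (((Primrec.list_getD 0).comp Primrec.fst (Primrec.const 0)).pair
      (((Primrec.list_getD 0).comp Primrec.fst (hσ.comp Primrec.snd)).pair Primrec.snd))
  · rintro u _ ⟨w, rfl⟩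
    beta_reduce
    rw [List.length_append, List.range_add, List.map_append]
    refine (List.map_congr_left fun i hi => ?_).symm ▸ List.prefix_append _ _
    have hi := List.mem_range.1 hi
    rw [List.getD_append _ _ _ _ (by omega), List.getD_append _ _ _ _ ((hle i).trans_lt hi)]
  · have key : ∀ k, ((List.range (bairePrefix p k).length).map fun i =>
        φ ((bairePrefix p k).getD 0 0, (bairePrefix p k).getD (σ i) 0, i)) =
        bairePrefix (fun i => φ (p 0, p (σ i), i)) k := by
      intro k
      rw [length_bairePrefix]
      refine List.map_congr_left fun i hi => ?_
      have hi := List.mem_range.1 hi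
      have hget : ∀ j < k, (bairePrefix p k).getD j 0 = p j := fun j hj => by
        rw [List.getD_eq_getElem?_getD, getElem?_bairePrefix hj, Option.getD_some]
      rw [hget 0 (by omega), hget _ ((hle i).trans_lt hi)]
    simp only [key]
    simp only [length_bairePrefix, Part.mem_some_iff]
    constructor
    · rintro rfl
      exact ⟨fun _ => rfl, fun n => ⟨n, le_rfl⟩⟩
    · rintro ⟨h, -⟩
      funext i
      have := congrArg (·[i]?) (h (i + 1))
      simpa only [getElem?_bairePrefix (Nat.lt_succ_self i), Option.some.injEq] using this.symm

/-! ### A relation with exactly one ideal in each fibre -/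

namespace FiberRel

/-- The number `x` codes a triple: a fibre in `ℕ`, a flag and a level. -/
def fiber (x : ℕ) : ℕ := x.unpair.1

def flag (x : ℕ) : Bool := x.unpair.2.bodd

def level (x : ℕ) : ℕ := x.unpair.2.div2

def code (n : ℕ) (b : Bool) (k : ℕ) : ℕ := Nat.pair n (Nat.bit b k)

@[simp] theorem fiber_code (n : ℕ) (b : Bool) (k : ℕ) : fiber (code n b k) = n := by
  simp [fiber, code]

@[simp] theorem flag_code (n : ℕ) (b : Bool) (k : ℕ) : flag (code n b k) = b := by
  simp [flag, code]

@[simp] theorem level_code (n : ℕ) (b : Bool) (k : ℕ) : level (code n b k) = k := by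
  simp [level, code]

theorem code_eta (x : ℕ) : code (fiber x) (flag x) (level x) = x := by
  simp [code, fiber, flag, level, Nat.bit_bodd_div2]

theorem primrec_fiber : Primrec fiber := Primrec.fst.comp Primrec.unpair

theorem primrec_flag : Primrec flag := Primrec.nat_bodd.comp (Primrec.snd.comp Primrec.unpair)

theorem primrec_level : Primrec level := Primrec.nat_div2.comp (Primrec.snd.comp Primrec.unpair)

theorem primrec_code : Primrec fun a : ℕ × Bool × ℕ => code a.1 a.2.1 a.2.2 := by
  refine Primrec₂.natPair.comp Primrec.fst
    ((Primrec.cond (Primrec.fst.comp Primrec.snd)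
      (Primrec.nat_double_succ.comp (Primrec.snd.comp Primrec.snd))
      (Primrec.nat_double.comp (Primrec.snd.comp Primrec.snd))).of_eq fun a => ?_)
  cases h : a.2.1 <;> simp [Nat.bit]

/-- In every fibre there are two chains, the lower one below the upper one. The chain with flag `b`
grows in fibre `n` as far as the counter `c b (n, ·)` does. -/
def rel (c : Bool → ℕ × ℕ → ℕ) (x y : ℕ) : Prop :=
  fiber x = fiber y ∧ ((flag x = false ∧ flag y = true) ∨
    (flag x = flag y ∧ level x < level y ∧ ∃ t, level y ≤ c (flag y) (fiber y, t)))

variable {c : Bool → ℕ × ℕ → ℕ} {A : Set ℕ}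

theorem rel_trans {x y z : ℕ} (hxy : rel c x y) (hyz : rel c y z) : rel c x z := by
  obtain ⟨h1, h2⟩ := hxy
  obtain ⟨h3, h4⟩ := hyz
  refine ⟨h1.trans h3, ?_⟩
  rcases h2 with ⟨h2, h2'⟩ | ⟨h2, h2', -⟩ <;> rcases h4 with ⟨h4, h4'⟩ | ⟨h4, h4', h5⟩
  · exact Or.inl ⟨h2, h4'⟩
  · exact Or.inl ⟨h2, h4 ▸ h2'⟩
  · exact Or.inl ⟨h2.trans h4, h4'⟩
  · exact Or.inr ⟨h2.trans h4, h2'.trans h4', h5⟩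

theorem rePred_rel (hc : ∀ b, Computable (c b)) : REPred fun a : ℕ × ℕ => rel c a.1 a.2 := by
  have eqRE : ∀ {β : Type} [Primcodable β] [DecidableEq β] {u v : ℕ × ℕ → β}, Primrec u → Primrec v →
      REPred fun a => u a = v a := fun hu hv =>
    (REPred.of_computable (Primrec.eq.decide.comp hu hv).to_comp).of_eq fun a => by simp
  have hlt : REPred fun a : ℕ × ℕ => level a.1 < level a.2 :=
    (REPred.of_computable (Primrec.nat_lt.decide.comp (primrec_level.comp Primrec.fst)
      (primrec_level.comp Primrec.snd)).to_comp).of_eq fun a => by simp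
  have hcount : REPred fun a : ℕ × ℕ => ∃ t, level a.2 ≤ c (flag a.2) (fiber a.2, t) := by
    refine .exists (P := fun b : (ℕ × ℕ) × ℕ => level b.1.2 ≤ c (flag b.1.2) (fiber b.1.2, b.2)) ?_
    have hy : Computable fun b : (ℕ × ℕ) × ℕ => b.1.2 := Computable.snd.comp .fst
    have hnt := (primrec_fiber.to_comp.comp hy).pair Computable.snd
    have hcb : Computable fun b : (ℕ × ℕ) × ℕ => c (flag b.1.2) (fiber b.1.2, b.2) :=
      (Computable.cond (primrec_flag.to_comp.comp hy) ((hc true).comp hnt)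
        ((hc false).comp hnt)).of_eq fun b => by cases flag b.1.2 <;> rfl
    exact (REPred.of_computable (Primrec.nat_le.decide.to_comp.comp
      (primrec_level.to_comp.comp hy) hcb)).of_eq fun b => by simp
  have hflag₁ := primrec_flag.comp (Primrec.fst (α := ℕ) (β := ℕ))
  have hflag₂ := primrec_flag.comp (Primrec.snd (α := ℕ) (β := ℕ))
  exact (eqRE (primrec_fiber.comp Primrec.fst) (primrec_fiber.comp Primrec.snd)).inter
    (((eqRE hflag₁ (Primrec.const false)).inter (eqRE hflag₂ (Primrec.const true))).union
      ((eqRE hflag₁ hflag₂).inter (hlt.inter hcount)))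

/-- The lower chain of the fibre `n`, together with the upper chain if `n ∈ A`. -/
def fiberIdeal (A : Set ℕ) (n : ℕ) : Set ℕ := {x | fiber x = n ∧ (flag x = true → n ∈ A)}

theorem fiberIdeal_injective : Function.Injective (fiberIdeal A) := by
  intro n m h
  have : code n false 0 ∈ fiberIdeal A m := h ▸ ⟨by simp, by simp⟩
  simpa using this.1

/-- The hypothesis `hc` says that in each fibre only the chain whose flag is the truth value of `n ∈
A` has an unbounded counter. That chain supplies the upper bounds. -/
theorem isRelIdeal_fiberIdeal
    (hc : ∀ b n, (b = true ↔ n ∈ A) ↔ ∀ K, ∃ t, K ≤ c b (n, t)) (n : ℕ) :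
    IsRelIdeal (rel c) (fiberIdeal A n) := by
  classical
  refine ⟨⟨code n false 0, by simp, by simp⟩, ?_, ?_⟩
  · rintro x y ⟨hy, hyA⟩ ⟨hxy, h⟩
    refine ⟨hxy.trans hy, fun hx => hyA ?_⟩
    rcases h with ⟨-, h⟩ | ⟨h, -⟩
    · exact h
    · exact h ▸ hx
  · have hrel : ∀ x ∈ fiberIdeal A n, ∀ K, level x < K →
        rel c x (code n (decide (n ∈ A)) K) := by
      rintro x ⟨hx, hxA⟩ K hK
      refine ⟨by simpa using hx, ?_⟩
      simp only [flag_code, level_code, fiber_code]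
      by_cases hf : flag x = decide (n ∈ A)
      · exact Or.inr ⟨hf, hK, (hc _ n).1 (by simp) K⟩
      · left
        -- If `n ∈ A`, then `x` is lower and the target upper; if `n ∉ A`, then `x` is lower like
        -- the target, contradicting `hf`.
        by_cases hn : n ∈ A <;> simp_all
    intro x hx y hy
    exact ⟨code n (decide (n ∈ A)) (max (level x) (level y) + 1), ⟨by simp, by simp⟩,
      hrel x hx _ (by omega), hrel y hy _ (by omega)⟩

theorem exists_eq_fiberIdeal
    (hc : ∀ b n, (b = true ↔ n ∈ A) ↔ ∀ K, ∃ t, K ≤ c b (n, t)) {I : Set ℕ}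
    (hI : IsRelIdeal (rel c) I) : ∃ n, fiberIdeal A n = I := by
  obtain ⟨x₀, hx₀⟩ := hI.nonempty
  set n := fiber x₀ with hn
  have hfib : ∀ x ∈ I, fiber x = n := fun x hx => by
    obtain ⟨z, -, hxz, h0z⟩ := hI.directed x hx x₀ hx₀
    exact hxz.1.trans h0z.1.symm
  -- `β` is the flag of the topmost chain that meets `I`.
  obtain ⟨β, hβ, x₁, hx₁, hx₁β⟩ :
      ∃ β, (∀ x ∈ I, flag x = true → β = true) ∧ ∃ x ∈ I, flag x = β := by
    by_cases h : ∃ x ∈ I, flag x = true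
    · exact ⟨true, fun _ _ _ => rfl, h⟩
    · exact ⟨false, fun x hx hf => absurd ⟨x, hx, hf⟩ h, x₀, hx₀,
        Bool.eq_false_iff.2 fun hf => h ⟨x₀, hx₀, hf⟩⟩
  have hstep : ∀ y ∈ I, flag y = β → ∃ z ∈ I, flag z = β ∧ level y < level z ∧
      ∃ t, level z ≤ c β (n, t) := by
    intro y hy hyβ
    -- Directedness applied to `y` twice gives an element strictly above it; `z` cannot lie on a
    -- higher chain by the choice of `β`, so its level is larger and within reach of the counter.
    obtain ⟨z, hz, ⟨-, h⟩, -⟩ := hI.directed y hy y hy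
    rcases h with ⟨h1, h2⟩ | ⟨h1, h2, h3⟩
    · rw [hyβ, hβ z hz h2] at h1
      cases h1
    · rw [← h1, hyβ, hfib z hz] at h3
      exact ⟨z, hz, h1 ▸ hyβ, h2, h3⟩
  have hclimb : ∀ K, ∃ z ∈ I, flag z = β ∧ K ≤ level z ∧ ∃ t, level z ≤ c β (n, t) := by
    intro K
    induction K with
    | zero =>
      obtain ⟨z, hz, h1, -, h2⟩ := hstep x₁ hx₁ hx₁β
      exact ⟨z, hz, h1, Nat.zero_le _, h2⟩
    | succ K ih =>
      obtain ⟨y, hy, hyβ, hK, -⟩ := ih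
      obtain ⟨z, hz, h1, h2, h3⟩ := hstep y hy hyβ
      exact ⟨z, hz, h1, by omega, h3⟩
  have hβA : β = true ↔ n ∈ A := (hc β n).2 fun K => by
    obtain ⟨z, -, -, hK, t, ht⟩ := hclimb K
    exact ⟨t, hK.trans ht⟩
  refine ⟨n, Set.Subset.antisymm ?_ fun x hx => ⟨hfib x hx, fun h => hβA.1 (hβ x hx h)⟩⟩
  rintro x ⟨hx, hxA⟩
  obtain ⟨z, hz, hzβ, hlev, ht⟩ := hclimb (level x + 1)
  refine hI.down_closed x z hz ⟨hx.trans (hfib z hz).symm, ?_⟩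
  rw [hzβ, hfib z hz]
  rcases Bool.eq_false_or_eq_true (flag x) with hf | hf
  · exact Or.inr ⟨by rw [hf, hβA.2 (hxA hf)], hlev, ht⟩
  · rcases Bool.eq_false_or_eq_true β with hb | hb
    · exact Or.inl ⟨hf, hb⟩
    · exact Or.inr ⟨by rw [hf, hb], hlev, ht⟩

end FiberRel

/-! ### The two realisers -/

namespace RepresentedSpace

open FiberRel

variable {A : Set ℕ}

theorem computableMap_spaceOf_idealSpace {r : ℕ → ℕ → Prop}
    {e : (spaceOf A).Carrier → (idealSpace r).Carrier}
    (he : ∀ x, (e x).1 = fiberIdeal A x.1.1) : ComputableMap (spaceOf A) (idealSpace r) e := by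
  -- Output `i = ⟨k, m⟩` has level `k`. It is upper only if `m` is odd, so that `p m` belongs to the
  -- Sierpiński part of the name, and `p m ≠ 0`; otherwise it is a lower element, which lies in the
  -- ideal in any case.
  refine ⟨_, isComputableFunctional_of_primrec (σ := fun i => i.unpair.2)
    (φ := fun a => code a.1 (a.2.2.unpair.2.bodd && !decide (a.2.1 = 0)) a.2.2.unpair.1)
    ?_ (Primrec.snd.comp Primrec.unpair) Nat.unpair_right_le, fun p x hx => ?_⟩
  · have hi : Primrec fun a : ℕ × ℕ × ℕ => a.2.2.unpair :=
      Primrec.unpair.comp (Primrec.snd.comp Primrec.snd)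
    exact primrec_code.comp (Primrec.fst.pair ((Primrec.and.comp
      (Primrec.nat_bodd.comp (Primrec.snd.comp hi)) (Primrec.not.comp (Primrec.eq.decide.comp
        (Primrec.fst.comp Primrec.snd) (Primrec.const 0)))).pair (Primrec.fst.comp hi)))
  · refine ⟨_, Part.mem_some _, mem_idealSpace_rep.2 ?_⟩
    have hA := spaceOf_snd_iff x
    rw [mem_spaceOf_rep] at hx
    rw [he]
    rw [hx] at hA ⊢
    ext y
    constructor
    · rintro ⟨hy, hyA⟩
      rcases Bool.eq_false_or_eq_true (flag y) with hf | hf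
      · obtain ⟨j, hj⟩ := hA.2 (hyA hf)
        refine ⟨Nat.pair (level y) (2 * j + 1), ?_⟩
        conv_rhs => rw [← code_eta y, hy, hf]
        simp [hj]
      · refine ⟨Nat.pair (level y) 0, ?_⟩
        conv_rhs => rw [← code_eta y, hy, hf]
        simp
    · rintro ⟨i, rfl⟩
      refine ⟨by simp, fun hf => hA.1 ?_⟩
      simp only [flag_code, Bool.and_eq_true, Bool.not_eq_true', decide_eq_false_iff_not] at hf
      refine ⟨i.unpair.2.div2, ?_⟩
      have := Nat.bodd_add_div2 i.unpair.2
      rw [hf.1] at this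
      rw [show 2 * i.unpair.2.div2 + 1 = i.unpair.2 by simp at this; omega]
      exact hf.2

theorem computableMap_idealSpace_spaceOf {r : ℕ → ℕ → Prop}
    {e : (idealSpace r).Carrier → (spaceOf A).Carrier}
    (he : ∀ I, I.1 = fiberIdeal A (e I).1.1) : ComputableMap (idealSpace r) (spaceOf A) e := by
  -- Even outputs repeat the fibre of `p 0`; output `2i + 1` reports whether `p i` is upper.
  refine ⟨_, isComputableFunctional_of_primrec (σ := Nat.div2)
    (φ := fun a => cond a.2.2.bodd (cond (flag a.2.1) 1 0) (fiber a.1))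
    ?_ Primrec.nat_div2 (fun i => ?_), fun p I hI => ?_⟩
  · exact Primrec.cond (Primrec.nat_bodd.comp (Primrec.snd.comp Primrec.snd))
      (Primrec.cond (primrec_flag.comp (Primrec.fst.comp Primrec.snd)) (Primrec.const 1)
        (Primrec.const 0)) (primrec_fiber.comp Primrec.fst)
  · rw [Nat.div2_val]
    exact Nat.div_le_self i 2
  · refine ⟨_, Part.mem_some _, mem_spaceOf_rep.2 (Prod.ext ?_ (propext ?_))⟩
    · have h0 : p 0 ∈ fiberIdeal A (e I).1.1 := he I ▸ mem_idealSpace_rep.1 hI ▸ ⟨0, rfl⟩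
      simpa using h0.1.symm
    · rw [spaceOf_snd_iff]
      have hr : Set.range p = fiberIdeal A (e I).1.1 := (mem_idealSpace_rep.1 hI) ▸ he I
      constructor
      · intro hn
        obtain ⟨i, hi⟩ : code (e I).1.1 true 0 ∈ Set.range p := hr ▸ ⟨by simp, fun _ => hn⟩
        exact ⟨i, by simp [hi]⟩
      · rintro ⟨i, hi⟩
        have hp : p i ∈ fiberIdeal A (e I).1.1 := hr ▸ ⟨i, rfl⟩
        refine hp.2 (Bool.not_eq_false _ ▸ fun hf => hi ?_)
        simp [hf]

end RepresentedSpace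

/-! ### Assembling the equivalence -/

theorem IsDelta02.precomputablyQuasiPolish {A : Set ℕ} (hA : IsDelta02 A) :
    (RepresentedSpace.spaceOf A).PrecomputablyQuasiPolish := by
  obtain ⟨c₀, hc₀, h₀⟩ := hA.1.compl.exists_counter
  obtain ⟨c₁, hc₁, h₁⟩ := hA.2.exists_counter
  let c : Bool → ℕ × ℕ → ℕ := fun b => cond b c₁ c₀
  have hc : ∀ b n, (b = true ↔ n ∈ A) ↔ ∀ K, ∃ t, K ≤ c b (n, t) := by
    rintro (_ | _) n
    · simpa [c] using h₀ n
    · simpa [c] using h₁ n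
  let E : (RepresentedSpace.spaceOf A).Carrier →
      (RepresentedSpace.idealSpace (FiberRel.rel c)).Carrier :=
    fun x => ⟨FiberRel.fiberIdeal A x.1.1, FiberRel.isRelIdeal_fiberIdeal hc _⟩
  have hE : Function.Bijective E := by
    constructor
    · intro x y h
      have h1 : x.1.1 = y.1.1 := FiberRel.fiberIdeal_injective (congrArg Subtype.val h)
      refine Subtype.ext (Prod.ext h1 (propext ?_))
      rw [RepresentedSpace.spaceOf_snd_iff, RepresentedSpace.spaceOf_snd_iff, h1]
    · rintro ⟨I, hI⟩
      obtain ⟨n, hn⟩ := FiberRel.exists_eq_fiberIdeal hc hI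
      exact ⟨⟨(n, n ∈ A), RepresentedSpace.mem_spaceOf_set Iff.rfl⟩, Subtype.ext hn⟩
  refine ⟨FiberRel.rel c, fun _ _ _ => FiberRel.rel_trans,
    FiberRel.rePred_rel (by rintro (_ | _) <;> assumption), Equiv.ofBijective E hE,
    RepresentedSpace.computableMap_spaceOf_idealSpace fun _ => rfl,
    RepresentedSpace.computableMap_idealSpace_spaceOf fun I => ?_⟩
  exact congrArg Subtype.val ((Equiv.ofBijective E hE).apply_symm_apply I).symm

theorem proposition24 (A : Set ℕ) :
    (RepresentedSpace.spaceOf A).PrecomputablyQuasiPolish ↔ IsDelta02 A :=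
  ⟨fun h => h.isDelta02, fun h => h.precomputablyQuasiPolish⟩
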